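/- Let $P_{Y|X}$ be a binary-input memoryless symmetric (BMS) channel: the inputs are $\{-,+\}$; the single-letter output laws $P_-,P_+$ on a measurable space $\mathcal Y$ have densities $P_-(y),P_+(y)$ with respect to a common reference measure $\nu$ (e.g. counting or Lebesgue measure); and there is a $\nu$-preserving involution $\sigma$ of $\mathcal Y$ with $P_+(y)=P_-(\sigma(y))$ for all $y$. Assume that $P_-\neq P_+$ and that $P_-$ is absolutely continuous with respect to $P_+$ (by symmetry, the two laws are then mutually absolutely continuous). Let $$\Lambda=\log\frac{P_+(Y)}{P_-(Y)},\ Y\sim P_+,\qquad Z=\int\sqrt{P_+P_-}\,d\nu,\qquad \chi=1-\sqrt{1-Z}.$$ There is exactly one $\lambda>0$ with $\mathbb E[e^{-\lambda\Lambda}]=1$. Let $\bar\Lambda$ be the exponentially tilted variable, whose law has density $e^{-\lambda x}$ with respect to the law of $\Lambda$. Let $\mathbb P$ and $\bar{\mathbb P}$ be the measures under which the increments $X_1,X_2,\dots$ are i.i.d. with the law of $\Lambda$ and of $\bar\Lambda$, respectively. For the walk $S_n=u+\sum_{k=1}^nX_k$ started at $u$, and $A>0$, put $$\tau_-=\inf\{n\ge1:S_n<0\},\qquad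 \tau_A=\inf\{n\ge1:S_n\ge A\}\qquad(\inf\emptyset=\infty),$$ $$p_{\mathrm{ruin}}(u,A)=\mathbb P_u[\tau_-<\tau_A],\qquad \bar p_{\mathrm{ruin}}(u,A)=\bar{\mathbb P}_u[\tau_-<\tau_A],\qquad \psi(0)=\mathbb P_0[\tau_-<\infty].$$ Fix $A>0$. Then $\bar p_{\mathrm{ruin}}(u,A)>0$ for every $u\in[0,A)$, and the ratio $f_A(u)=p_{\mathrm{ruin}}(u,A)/\bar p_{\mathrm{ruin}}(u,A)$ satisfies: (i) $f_A(u)\le e^{-u}\le 1$ for every $u\in[0,A)$. (ii) $f_A$ is bounded above on $[0,A)$, and $$\sup_{u\in[0,A)}f_A(u)\le\max\Big\{\frac{\psi(0)}{1-e^{-A/2}},\,e^{-A/2}\Big\}\le\max\Big\{\frac{\chi}{1-e^{-A/2}},\,e^{-A/2}\Big\}.$$ The same conclusions hold if $\tau_A$ is replaced throughout by $\inf\{n\ge1:S_n>A\}$. -/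

import Mathlib

open MeasureTheory Set

/-- A binary-input memoryless symmetric (BMS) channel with input alphabet `{-, +}` and output
alphabet `𝒴`. The single-letter transition laws `P_-`, `P_+` have densities `pMinus`, `pPlus` with
respect to a common reference measure `ref` (counting measure for a probability mass function,
Lebesgue measure for a probability density). The symmetry is an involution `flip` of the output
alphabet, preserving the reference measure, with `P_+(y) = P_-(flip y)`; for a channel with
relabelled real outputs it is `y ↦ -y`. Memorylessness means that successive outputs for a constant
input are independent with the single-letter law; see `walkLaw`. -/
structure BMSChannel (𝒴 : Type*) [MeasurableSpace 𝒴] where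
  ref : Measure 𝒴
  pPlus : 𝒴 → ℝ
  pMinus : 𝒴 → ℝ
  measurable_pPlus : Measurable pPlus
  measurable_pMinus : Measurable pMinus
  pPlus_nonneg : ∀ y, 0 ≤ pPlus y
  pMinus_nonneg : ∀ y, 0 ≤ pMinus y
  lintegral_pPlus : ∫⁻ y, ENNReal.ofReal (pPlus y) ∂ref = 1
  lintegral_pMinus : ∫⁻ y, ENNReal.ofReal (pMinus y) ∂ref = 1
  flip : 𝒴 → 𝒴
  flip_involutive : Function.Involutive flip
  flip_preserving : MeasurePreserving flip ref ref
  symm : ∀ y, pPlus y = pMinus (flip y)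

namespace BMSChannel

variable {𝒴 : Type*} [MeasurableSpace 𝒴]

/-- The output law `P_+` given the input `+`. -/
noncomputable def lawPlus (W : BMSChannel 𝒴) : Measure 𝒴 :=
  W.ref.withDensity (fun y => ENNReal.ofReal (W.pPlus y))

/-- The output law `P_-` given the input `-`. -/
noncomputable def lawMinus (W : BMSChannel 𝒴) : Measure 𝒴 :=
  W.ref.withDensity (fun y => ENNReal.ofReal (W.pMinus y))

/-- The log-likelihood ratio `y ↦ log (P_+(y) / P_-(y))`. -/
noncomputable def llr (W : BMSChannel 𝒴) (y : 𝒴) : ℝ :=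
  Real.log (W.pPlus y / W.pMinus y)

/-- The Bhattacharyya parameter `Z = ∫ √(P_+ P_-)`. -/
noncomputable def bhattacharyya (W : BMSChannel 𝒴) : ℝ :=
  ∫ y, Real.sqrt (W.pPlus y * W.pMinus y) ∂W.ref

/-- The ruin parameter `χ = 1 - √(1 - Z)`. -/
noncomputable def ruinParameter (W : BMSChannel 𝒴) : ℝ :=
  1 - Real.sqrt (1 - W.bhattacharyya)

theorem measurable_llr (W : BMSChannel 𝒴) : Measurable W.llr :=
  Real.measurable_log.comp (W.measurable_pPlus.div W.measurable_pMinus)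

theorem isProbabilityMeasure_lawPlus (W : BMSChannel 𝒴) : IsProbabilityMeasure W.lawPlus :=
  ⟨by rw [lawPlus, withDensity_apply _ MeasurableSet.univ, Measure.restrict_univ,
    W.lintegral_pPlus]⟩

/-- The law of the LLR random variable `Λ = log (P_+(Y) / P_-(Y))`, `Y ∼ P_+`. -/
noncomputable def llrLaw (W : BMSChannel 𝒴) : ProbabilityMeasure ℝ :=
  ⟨W.lawPlus.map W.llr,
    have := W.isProbabilityMeasure_lawPlus
    Measure.isProbabilityMeasure_map W.measurable_llr.aemeasurable⟩

end BMSChannel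

/-- `lam > 0` solves `𝔼[exp (-lam X)] = 1` for `X ∼ μ`. -/
def IsTiltParameter (μ : ProbabilityMeasure ℝ) (lam : ℝ) : Prop :=
  0 < lam ∧ ∫⁻ x, ENNReal.ofReal (Real.exp (-(lam * x))) ∂(μ : Measure ℝ) = 1

/-- The law of the exponentially tilted variable: density `exp (-lam x)` with respect to `μ`. -/
noncomputable def tiltedLaw (μ : ProbabilityMeasure ℝ) (lam : ℝ) (h : IsTiltParameter μ lam) :
    ProbabilityMeasure ℝ :=
  ⟨(μ : Measure ℝ).withDensity (fun x => ENNReal.ofReal (Real.exp (-(lam * x)))),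
    ⟨by rw [withDensity_apply _ MeasurableSet.univ, Measure.restrict_univ, h.2]⟩⟩

/-- The law of an i.i.d. sequence of increments with common law `μ`; the `k`-th increment
(`k = 1, 2, …`) is the coordinate `k - 1`. -/
noncomputable def walkLaw (μ : ProbabilityMeasure ℝ) : Measure (ℕ → ℝ) :=
  Measure.infinitePi (fun _ : ℕ => (μ : Measure ℝ))

/-- The random walk started at `x`: after `n` steps it is at `x` plus the first `n` increments. -/
def walk (x : ℝ) (ω : ℕ → ℝ) (n : ℕ) : ℝ :=
  x + ∑ i ∈ Finset.range n, ω i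

/-- The hitting time `inf {n ≥ 1 : S_n ∈ s}` of the walk started at `x`, with `inf ∅ = ∞`. -/
noncomputable def hitTime (x : ℝ) (s : Set ℝ) (ω : ℕ → ℝ) : ℕ∞ :=
  ⨅ (n : ℕ) (_ : 1 ≤ n ∧ walk x ω n ∈ s), (n : ℕ∞)

/-- The ultimate ruin probability `ψ(x) = ℙ_x[τ_- < ∞]`, `τ_-` the hitting time of `(-∞, 0)`. -/
noncomputable def ultimateRuin (μ : ProbabilityMeasure ℝ) (x : ℝ) : ℝ :=
  (walkLaw μ).real {ω | hitTime x (Iio 0) ω < ⊤}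

/-- The two-sided ruin probability: the walk with increment law `μ` started at `x` enters `(-∞, 0)`
before it enters the upper exit region `U`. -/
noncomputable def twoSidedRuin (μ : ProbabilityMeasure ℝ) (x : ℝ) (U : Set ℝ) : ℝ :=
  (walkLaw μ).real {ω | hitTime x (Iio 0) ω < hitTime x U ω}

/-- The ratio of the two-sided ruin probability for increment law `μ` to that for its tilt. -/
noncomputable def exitRatio (μ : ProbabilityMeasure ℝ) (lam : ℝ) (h : IsTiltParameter μ lam)
    (U : Set ℝ) (u : ℝ) : ℝ :=
  twoSidedRuin μ u U / twoSidedRuin (tiltedLaw μ lam h) u U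

/-! Write `μ` for the law of `Λ`. Channel symmetry says that reflecting `μ` is the same as tilting
it by `exp (-x)`. Total mass then shows that `1` is a tilt parameter, and strict convexity of the
moment generating function makes it the only one. Let `ν` be this tilt, and `q` the normalised tilt
by `exp (-x/2)`; then `q` is symmetric, and its normalising constant is `Z`.

All estimates are changes of measure on finite-horizon first-entry events. At ruin `S_n < 0`, so the
likelihood ratio of `μ` to `ν` is `exp (S_n - u) ≤ exp (-u)`: this is (i). Under `ν` the barrier `A`
is reached with probability at most `exp (-(A - u))`, and the walk almost surely becomes negative,
so ruin first has probability at least `1 - exp (-(A - u))`. For (ii), split at `u = A/2`: below,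
compare `ψ(0)` with this lower bound; above, use (i).

For `ψ(0) ≤ χ`, let `c n` be the `q`-probability that the walk from `0` stays nonnegative up to step
`n`. Passing from `q` to `μ` costs at most `Z ^ (n + 1)` on ruin at step `n + 1`, so `ψ(0) ≤ ∑ Z ^
(n + 1) * (c n - c (n + 1)) = 1 - (1 - Z) * C(Z)`, with `C` the generating function of `c`.
Splitting a path at its minimum shows that `c` convolved with itself is at least `1`, so `C(Z) ^ 2 ≥
1 / (1 - Z)`. -/

/-! ### Change of measure and independence for i.i.d. increments -/

/-- Finite product measures with densities: the density of the product is the product of the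
densities. -/
theorem pi_eq_withDensity_prod {ι : Type*} [Fintype ι] (μ ν : ProbabilityMeasure ℝ)
    {g : ℝ → ENNReal} (hg : Measurable g) (hν : (ν : Measure ℝ) = (μ : Measure ℝ).withDensity g) :
    Measure.pi (fun _ : ι => (ν : Measure ℝ)) =
      (Measure.pi fun _ : ι => (μ : Measure ℝ)).withDensity (fun x => ∏ i, g (x i)) := by
  refine Measure.pi_eq fun s hs => ?_
  have hS : MeasurableSet (Set.pi univ s) := MeasurableSet.univ_pi hs
  have hind : ∀ i, Measurable ((s i).indicator g) := fun i => hg.indicator (hs i)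
  have hpt : (Set.pi univ s).indicator (fun x : ι → ℝ => ∏ i, g (x i)) =
      fun x => ∏ i, (s i).indicator g (x i) := by
    funext x
    by_cases hx : x ∈ Set.pi univ s
    · rw [indicator_of_mem hx]
      exact Finset.prod_congr rfl fun i _ => (indicator_of_mem (hx i (mem_univ i)) g).symm
    · rw [indicator_of_notMem hx]
      obtain ⟨i, hi⟩ : ∃ i, x i ∉ s i := by simpa [Set.mem_pi] using hx
      exact (Finset.prod_eq_zero (Finset.mem_univ i) (indicator_of_notMem hi g)).symm
  rw [withDensity_apply _ hS, ← lintegral_indicator hS, hpt,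
    ProbabilityTheory.lintegral_prod_eq_prod_lintegral_of_indepFun Finset.univ
      (fun i (x : ι → ℝ) => (s i).indicator g (x i))
      (ProbabilityTheory.iIndepFun_pi fun i => (hind i).aemeasurable)
      fun i => (hind i).comp (measurable_pi_apply i)]
  refine Finset.prod_congr rfl fun i _ => ?_
  rw [(measurePreserving_eval (fun _ : ι => (μ : Measure ℝ)) i).lintegral_comp (hind i),
    lintegral_indicator (hs i), hν, withDensity_apply _ (hs i)]

/-- The event `E` is determined by the first `n` increments. -/
def DeterminedBy (n : ℕ) (E : Set (ℕ → ℝ)) : Prop :=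
  ∀ ω ω' : ℕ → ℝ, (∀ i < n, ω i = ω' i) → ω ∈ E → ω' ∈ E

/-- Extend a finite sequence of increments by zeros. -/
def extendZero (n : ℕ) (x : Fin n → ℝ) (i : ℕ) : ℝ :=
  if h : i < n then x ⟨i, h⟩ else 0

theorem measurable_extendZero (n : ℕ) : Measurable (extendZero n) := by
  refine measurable_pi_lambda _ fun i => ?_
  unfold extendZero
  split_ifs
  · exact measurable_pi_apply _
  · exact measurable_const

instance (μ : ProbabilityMeasure ℝ) : IsProbabilityMeasure (walkLaw μ) := by
  unfold walkLaw; infer_instance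

theorem map_prefix_walkLaw (μ : ProbabilityMeasure ℝ) (n : ℕ) :
    (walkLaw μ).map (fun ω (i : Fin n) => ω i) = Measure.pi fun _ : Fin n => (μ : Measure ℝ) := by
  rw [← Measure.infinitePi_eq_pi]
  exact Measure.map_infinitePi_infinitePi_of_inj (P := fun _ : ℕ => (μ : Measure ℝ))
    (f := fun i : Fin n => (i : ℕ)) Fin.val_injective

theorem DeterminedBy.eq_preimage {n : ℕ} {E : Set (ℕ → ℝ)} (h : DeterminedBy n E) :
    E = (fun ω (i : Fin n) => ω i) ⁻¹' (extendZero n ⁻¹' E) := by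
  ext ω
  have key : ∀ i < n, ω i = extendZero n (fun i : Fin n => ω i) i := fun i hi => by
    simp [extendZero, hi]
  exact ⟨h _ _ key, h _ _ fun i hi => (key i hi).symm⟩

theorem DeterminedBy.walkLaw_apply {n : ℕ} {E : Set (ℕ → ℝ)} (h : DeterminedBy n E)
    (hE : MeasurableSet E) (μ : ProbabilityMeasure ℝ) :
    walkLaw μ E = Measure.pi (fun _ : Fin n => (μ : Measure ℝ)) (extendZero n ⁻¹' E) := by
  rw [← map_prefix_walkLaw, Measure.map_apply (by fun_prop) (measurable_extendZero n hE),
    ← h.eq_preimage]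

/-- Change of measure for events determined by finitely many increments. -/
theorem DeterminedBy.walkLaw_le {n : ℕ} {E : Set (ℕ → ℝ)} (h : DeterminedBy n E)
    (hE : MeasurableSet E) {μ ν : ProbabilityMeasure ℝ} {g : ℝ → ENNReal} (hg : Measurable g)
    (hν : (ν : Measure ℝ) = (μ : Measure ℝ).withDensity g) {c : ENNReal}
    (hc : ∀ ω ∈ E, ∏ i ∈ Finset.range n, g (ω i) ≤ c) :
    walkLaw ν E ≤ c * walkLaw μ E := by
  rw [h.walkLaw_apply hE, h.walkLaw_apply hE, pi_eq_withDensity_prod μ ν hg hν]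
  have hS := measurable_extendZero n hE
  rw [withDensity_apply _ hS, ← setLIntegral_const]
  refine setLIntegral_mono measurable_const fun x hx => ?_
  have := hc _ hx
  rw [Finset.prod_range] at this
  simpa [extendZero] using this

/-- Change of measure along `exp (a + b x)`, for finite-horizon events. -/
theorem DeterminedBy.walkLaw_real_le {n : ℕ} {E : Set (ℕ → ℝ)} (h : DeterminedBy n E)
    (hE : MeasurableSet E) {μ ν : ProbabilityMeasure ℝ} {a b : ℝ}
    (hν : (ν : Measure ℝ) = (μ : Measure ℝ).withDensity fun x => ENNReal.ofReal (Real.exp (a + b * x)))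
    {c : ℝ} (hc : ∀ ω ∈ E, n * a + b * ∑ i ∈ Finset.range n, ω i ≤ c) :
    (walkLaw ν).real E ≤ Real.exp c * (walkLaw μ).real E := by
  have := h.walkLaw_le hE (μ := μ) (ν := ν) (by fun_prop) hν (c := ENNReal.ofReal (Real.exp c))
    fun ω hω => by
      rw [← ENNReal.ofReal_prod_of_nonneg fun i _ => (Real.exp_pos _).le, ← Real.exp_sum]
      refine ENNReal.ofReal_le_ofReal (Real.exp_le_exp.2 ?_)
      simpa [Finset.sum_add_distrib, Finset.mul_sum] using hc ω hω
  have h2 := ENNReal.toReal_mono (by finiteness) this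
  rwa [ENNReal.toReal_mul, ENNReal.toReal_ofReal (Real.exp_pos c).le] at h2

/-- Reindexing the increments by an injective map preserves the law of the walk. -/
theorem measurePreserving_reindex (μ : ProbabilityMeasure ℝ) {e : ℕ → ℕ}
    (he : Function.Injective e) :
    MeasurePreserving (fun (ω : ℕ → ℝ) i => ω (e i)) (walkLaw μ) (walkLaw μ) :=
  ⟨by fun_prop, Measure.map_infinitePi_infinitePi_of_inj (P := fun _ : ℕ => (μ : Measure ℝ)) he⟩

/-- Negating the increments maps the walk of `μ` to the walk of its reflection. -/
theorem measurePreserving_neg_walkLaw {μ ν : ProbabilityMeasure ℝ}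
    (h : (μ : Measure ℝ).map (fun x => -x) = ν) :
    MeasurePreserving (fun (ω : ℕ → ℝ) i => -ω i) (walkLaw μ) (walkLaw ν) := by
  refine ⟨by fun_prop, ?_⟩
  unfold walkLaw
  rw [Measure.infinitePi_map_pi (f := fun (_ : ℕ) (x : ℝ) => -x) _ (fun _ => measurable_neg), h]

/-- Events determined by the first `k` and by the later increments are independent. -/
theorem walkLaw_inter_shift (μ : ProbabilityMeasure ℝ) {k m : ℕ} {E F : Set (ℕ → ℝ)}
    (hE : DeterminedBy k E) (hF : DeterminedBy m F) (mE : MeasurableSet E) (mF : MeasurableSet F) :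
    (walkLaw μ).real (E ∩ (fun ω i => ω (k + i)) ⁻¹' F) =
      (walkLaw μ).real E * (walkLaw μ).real F := by
  have hdisj : Disjoint (Finset.range k) (Finset.Ico k (k + m)) := by
    rw [Finset.disjoint_left]; intro i; simp; omega
  have hind : ProbabilityTheory.iIndepFun (fun (i : ℕ) (ω : ℕ → ℝ) => ω i) (walkLaw μ) :=
    ProbabilityTheory.iIndepFun_infinitePi (P := fun _ : ℕ => (μ : Measure ℝ))
      (X := fun _ x => x) fun _ => measurable_id
  have h := hind.indepFun_finset _ _ hdisj fun i => measurable_pi_apply i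
  let ext1 : (Finset.range k → ℝ) → ℕ → ℝ := fun x i =>
    if hi : i ∈ Finset.range k then x ⟨i, hi⟩ else 0
  let ext2 : (Finset.Ico k (k + m) → ℝ) → ℕ → ℝ := fun x i =>
    if hi : k + i ∈ Finset.Ico k (k + m) then x ⟨k + i, hi⟩ else 0
  have m1 : Measurable ext1 := measurable_pi_lambda _ fun i => by
    simp only [ext1]; split_ifs <;> fun_prop
  have m2 : Measurable ext2 := measurable_pi_lambda _ fun i => by
    simp only [ext2]; split_ifs <;> fun_prop
  have e1 : E = (fun (ω : ℕ → ℝ) (i : Finset.range k) => ω i) ⁻¹' (ext1 ⁻¹' E) := by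
    ext ω
    have key : ∀ i < k, ω i = ext1 (fun i => ω i) i := fun i hi => by simp [ext1, hi]
    exact ⟨hE _ _ key, hE _ _ fun i hi => (key i hi).symm⟩
  have e2 : (fun (ω : ℕ → ℝ) i => ω (k + i)) ⁻¹' F =
      (fun (ω : ℕ → ℝ) (i : Finset.Ico k (k + m)) => ω i) ⁻¹' (ext2 ⁻¹' F) := by
    ext ω
    have key : ∀ i < m, ω (k + i) = ext2 (fun i => ω i) i := fun i hi => by simp [ext2, hi]
    exact ⟨hF _ _ key, hF _ _ fun i hi => (key i hi).symm⟩
  have hmul := h.measure_inter_preimage_eq_mul (ext1 ⁻¹' E) (ext2 ⁻¹' F) (m1 mE) (m2 mF)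
  rw [← e1, ← e2, (measurePreserving_reindex μ (add_right_injective k)).measure_preimage
    mF.nullMeasurableSet] at hmul
  simp only [Measure.real, hmul, ENNReal.toReal_mul]

/-! ### Hitting times and first-entry events -/

theorem measurable_walk (x : ℝ) (n : ℕ) : Measurable fun ω => walk x ω n := by
  unfold walk; fun_prop

theorem walk_congr {x : ℝ} {ω ω' : ℕ → ℝ} {n k : ℕ} (h : ∀ i < n, ω i = ω' i) (hk : k ≤ n) :
    walk x ω k = walk x ω' k := by
  unfold walk
  rw [Finset.sum_congr rfl fun i hi => h i ((Finset.mem_range.1 hi).trans_le hk)]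

/-- The walk started at `x` enters `s` for the first time at step `n + 1`, not having visited `U`
at any of the steps `1, …, n + 1`. -/
def firstEntry (x : ℝ) (s U : Set ℝ) (n : ℕ) : Set (ℕ → ℝ) :=
  {ω | walk x ω (n + 1) ∈ s ∧ (∀ k < n, walk x ω (k + 1) ∉ s) ∧ ∀ k ≤ n, walk x ω (k + 1) ∉ U}

theorem measurableSet_firstEntry (x : ℝ) {s U : Set ℝ} (hs : MeasurableSet s)
    (hU : MeasurableSet U) (n : ℕ) : MeasurableSet (firstEntry x s U n) := by
  have h1 := fun k => measurable_walk x k hs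
  have h2 := fun k => measurable_walk x k hU
  have heq : firstEntry x s U n = (fun ω => walk x ω (n + 1)) ⁻¹' s ∩
      ((⋂ k, ⋂ (_ : k < n), ((fun ω => walk x ω (k + 1)) ⁻¹' s)ᶜ) ∩
        ⋂ k, ⋂ (_ : k ≤ n), ((fun ω => walk x ω (k + 1)) ⁻¹' U)ᶜ) := by
    ext ω; simp [firstEntry]
  rw [heq]
  exact (h1 _).inter (.inter (.iInter fun k => .iInter fun _ => (h1 _).compl)
    (.iInter fun k => .iInter fun _ => (h2 _).compl))

theorem determinedBy_firstEntry (x : ℝ) (s U : Set ℝ) (n : ℕ) :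
    DeterminedBy (n + 1) (firstEntry x s U n) := by
  rintro ω ω' h ⟨h1, h2, h3⟩
  refine ⟨?_, fun k hk => ?_, fun k hk => ?_⟩
  · rwa [← walk_congr h le_rfl]
  · rw [← walk_congr h (by omega)]; exact h2 k hk
  · rw [← walk_congr h (by omega)]; exact h3 k hk

theorem pairwise_disjoint_firstEntry (x : ℝ) (s U : Set ℝ) :
    Pairwise (Function.onFun Disjoint (firstEntry x s U)) := by
  intro m n hmn
  rw [Function.onFun, Set.disjoint_left]
  rintro ω ⟨h1, h2, -⟩ ⟨h1', h2', -⟩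
  rcases lt_or_gt_of_ne hmn with h | h
  · exact h2' m h h1
  · exact h2 n h h1'

theorem hitTime_lt_iff (x : ℝ) (s : Set ℝ) (ω : ℕ → ℝ) (t : ℕ∞) :
    hitTime x s ω < t ↔ ∃ n : ℕ, walk x ω (n + 1) ∈ s ∧ ((n + 1 : ℕ) : ℕ∞) < t := by
  simp only [hitTime, iInf_lt_iff]
  constructor
  · rintro ⟨n, ⟨h1, h2⟩, h3⟩
    obtain ⟨m, rfl⟩ := Nat.exists_eq_add_of_le' h1
    exact ⟨m, h2, h3⟩
  · rintro ⟨n, h1, h2⟩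
    exact ⟨n + 1, ⟨by omega, h1⟩, h2⟩

theorem lt_hitTime_iff (x : ℝ) (s : Set ℝ) (ω : ℕ → ℝ) (n : ℕ) :
    ((n + 1 : ℕ) : ℕ∞) < hitTime x s ω ↔ ∀ k ≤ n, walk x ω (k + 1) ∉ s := by
  constructor
  · intro h k hk hmem
    have : hitTime x s ω ≤ ((k + 1 : ℕ) : ℕ∞) := iInf₂_le (k + 1) ⟨by omega, hmem⟩
    have := h.trans_le this
    rw [Nat.cast_lt] at this
    omega
  · intro h
    by_contra hle
    rw [not_lt] at hle
    have : hitTime x s ω < ((n + 2 : ℕ) : ℕ∞) :=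
      hle.trans_lt (by rw [Nat.cast_lt]; omega)
    obtain ⟨k, hk, hlt⟩ := (hitTime_lt_iff ..).1 this
    rw [Nat.cast_lt] at hlt
    exact h k (by omega) hk

/-- Reduces the comparison of two possibly infinite times to disjoint finite-horizon events, where
the change of measure applies. The case `U = ∅` is the event of ever entering `s`. -/
theorem setOf_hitTime_lt_hitTime (x : ℝ) (s U : Set ℝ) :
    {ω | hitTime x s ω < hitTime x U ω} = ⋃ n, firstEntry x s U n := by
  classical
  ext ω
  simp only [mem_ofPred_eq, mem_iUnion, hitTime_lt_iff x s ω, lt_hitTime_iff]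
  constructor
  · rintro ⟨n, h1, h2⟩
    have hex : ∃ n, walk x ω (n + 1) ∈ s := ⟨n, h1⟩
    exact ⟨Nat.find hex, Nat.find_spec hex, fun k hk => Nat.find_min hex hk,
      fun k hk => h2 k (hk.trans (Nat.find_min' hex h1))⟩
  · rintro ⟨n, h1, -, h3⟩
    exact ⟨n, h1, h3⟩

theorem hitTime_empty (x : ℝ) (ω : ℕ → ℝ) : hitTime x ∅ ω = ⊤ := by
  simp [hitTime]

theorem hitTime_lt_top_iff (x : ℝ) (s : Set ℝ) (ω : ℕ → ℝ) :
    hitTime x s ω < ⊤ ↔ ∃ n : ℕ, walk x ω (n + 1) ∈ s := by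
  simp [hitTime_lt_iff, -Nat.cast_add]

theorem hasSum_firstEntry (μ : ProbabilityMeasure ℝ) (x : ℝ) {s U : Set ℝ} (hs : MeasurableSet s)
    (hU : MeasurableSet U) :
    HasSum (fun n => (walkLaw μ).real (firstEntry x s U n))
      ((walkLaw μ).real {ω | hitTime x s ω < hitTime x U ω}) := by
  have h := measure_iUnion (μ := walkLaw μ) (pairwise_disjoint_firstEntry x s U)
    (measurableSet_firstEntry x hs hU)
  have hfin : ∑' n, walkLaw μ (firstEntry x s U n) ≠ ⊤ := h ▸ measure_ne_top _ _
  rw [setOf_hitTime_lt_hitTime, Measure.real, h,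
    ENNReal.tsum_toReal_eq (ENNReal.ne_top_of_tsum_ne_top hfin)]
  exact (ENNReal.summable_toReal hfin).hasSum

/-! ### Ruin bounds by exponential tilting -/

/-- Change of measure for the event that the walk enters `s` before `U`. -/
theorem walkLaw_real_hitTime_lt_le {μ ν : ProbabilityMeasure ℝ} {b c x : ℝ}
    (hν : (ν : Measure ℝ) = (μ : Measure ℝ).withDensity fun y => ENNReal.ofReal (Real.exp (0 + b * y)))
    {s U : Set ℝ} (hs : MeasurableSet s) (hU : MeasurableSet U)
    (hc : ∀ y ∈ s, b * (y - x) ≤ c) :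
    (walkLaw ν).real {ω | hitTime x s ω < hitTime x U ω} ≤
      Real.exp c * (walkLaw μ).real {ω | hitTime x s ω < hitTime x U ω} := by
  refine hasSum_le (fun n => ?_) (hasSum_firstEntry ν x hs hU)
    ((hasSum_firstEntry μ x hs hU).mul_left _)
  refine (determinedBy_firstEntry x s U n).walkLaw_real_le
    (measurableSet_firstEntry x hs hU n) hν fun ω hω => ?_
  have := hc _ hω.1
  simpa [walk] using this

/-- The likelihood ratio at ruin is `exp (y - u)` with `y < 0`. The shape `0 + 1 * x` matches the
general density `exp (a + b * x)`. -/
theorem twoSidedRuin_le_tilted {μ ν : ProbabilityMeasure ℝ}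
    (hμ : (μ : Measure ℝ) = (ν : Measure ℝ).withDensity fun x => ENNReal.ofReal (Real.exp (0 + 1 * x)))
    {U : Set ℝ} (hU : MeasurableSet U) (u : ℝ) :
    twoSidedRuin μ u U ≤ Real.exp (-u) * twoSidedRuin ν u U :=
  walkLaw_real_hitTime_lt_le hμ measurableSet_Iio hU fun y hy => by
    have : y < 0 := hy
    linarith

/-- Lundberg's bound for the upper barrier under the tilted law. -/
theorem walkLaw_real_hitTime_lt_top_le {μ ν : ProbabilityMeasure ℝ}
    (hν : (ν : Measure ℝ) = (μ : Measure ℝ).withDensity fun x => ENNReal.ofReal (Real.exp (0 + -1 * x)))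
    {U : Set ℝ} (hU : MeasurableSet U) {A : ℝ} (hA : U ⊆ Ici A) (u : ℝ) :
    (walkLaw ν).real {ω | hitTime u U ω < ⊤} ≤ Real.exp (-(A - u)) := by
  have h := walkLaw_real_hitTime_lt_le (x := u) hν hU MeasurableSet.empty (c := -(A - u))
    fun y hy => by
      have : A ≤ y := hA hy
      linarith
  simp only [hitTime_empty] at h
  exact h.trans (mul_le_of_le_one_right (Real.exp_pos _).le measureReal_le_one)

/-- A walk whose increments have a moment generating function below one at some point is eventually
negative. -/
theorem walkLaw_real_forall_nonneg {q ν : ProbabilityMeasure ℝ} {ζ : ℝ} (hζ : 0 < ζ)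
    (hν : (ν : Measure ℝ) =
      (q : Measure ℝ).withDensity fun x => ENNReal.ofReal (Real.exp (-ζ + -(1 / 2) * x))) (u : ℝ) :
    (walkLaw ν).real {ω | ∀ n : ℕ, 0 ≤ walk u ω (n + 1)} = 0 := by
  refine le_antisymm ?_ measureReal_nonneg
  have hle : ∀ n : ℕ, (walkLaw ν).real {ω | ∀ n : ℕ, 0 ≤ walk u ω (n + 1)} ≤
      Real.exp (u / 2 - ζ) * Real.exp (-ζ) ^ n := by
    -- On `S_(n+1) ≥ 0` the increments sum to at least `-u`, so the density is at most `exp (u / 2 -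
    -- (n + 1) * ζ)`, which tends to `0`.
    intro n
    have hdet : DeterminedBy (n + 1) {ω | 0 ≤ walk u ω (n + 1)} := fun ω ω' h hω => by
      have hω : 0 ≤ walk u ω (n + 1) := hω
      rwa [walk_congr h le_rfl] at hω
    have h := hdet.walkLaw_real_le (measurableSet_le measurable_const (measurable_walk u _)) hν
      (c := u / 2 - ζ + n * -ζ) fun ω hω => by
        have : 0 ≤ u + ∑ i ∈ Finset.range (n + 1), ω i := hω
        push_cast
        linarith
    rw [Real.exp_add, Real.exp_nat_mul] at h
    refine (measureReal_mono fun ω hω => ?_).trans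
      (h.trans (mul_le_of_le_one_right (by positivity) measureReal_le_one))
    exact hω n
  have hlim : Filter.Tendsto (fun n : ℕ => Real.exp (u / 2 - ζ) * Real.exp (-ζ) ^ n) Filter.atTop
      (nhds 0) := by
    simpa using (tendsto_pow_atTop_nhds_zero_of_lt_one (Real.exp_pos (-ζ)).le
      (Real.exp_lt_one_iff.2 (by linarith))).const_mul (Real.exp (u / 2 - ζ))
  exact ge_of_tendsto' hlim hle

/-- A path not ruined before `U` either reaches `U` (Lundberg's bound) or stays nonnegative forever
(a null event). -/
theorem one_sub_exp_le_twoSidedRuin {μ ν q : ProbabilityMeasure ℝ} {ζ : ℝ} (hζ : 0 < ζ)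
    (hν : (ν : Measure ℝ) = (μ : Measure ℝ).withDensity fun x => ENNReal.ofReal (Real.exp (0 + -1 * x)))
    (hq : (ν : Measure ℝ) =
      (q : Measure ℝ).withDensity fun x => ENNReal.ofReal (Real.exp (-ζ + -(1 / 2) * x)))
    {U : Set ℝ} (hU : MeasurableSet U) {A : ℝ} (hA : U ⊆ Ici A) (u : ℝ) :
    1 - Real.exp (-(A - u)) ≤ twoSidedRuin ν u U := by
  have hcover : (univ : Set (ℕ → ℝ)) ⊆ {ω | hitTime u (Iio 0) ω < hitTime u U ω} ∪
      ({ω | hitTime u U ω < ⊤} ∪ {ω | ∀ n : ℕ, 0 ≤ walk u ω (n + 1)}) := by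
    intro ω _
    by_cases h1 : hitTime u U ω < ⊤
    · exact Or.inr (Or.inl h1)
    by_cases h2 : ∀ n : ℕ, 0 ≤ walk u ω (n + 1)
    · exact Or.inr (Or.inr h2)
    left
    push Not at h2
    rw [not_lt_top_iff] at h1
    simp only [mem_ofPred_eq, h1]
    exact (hitTime_lt_top_iff ..).2 h2
  have h := (measureReal_mono (μ := walkLaw ν) hcover).trans ((measureReal_union_le _ _).trans
    (add_le_add_right (measureReal_union_le _ _) _))
  rw [probReal_univ, walkLaw_real_forall_nonneg hζ hq] at h
  have h2 := walkLaw_real_hitTime_lt_top_le hν hU hA u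
  unfold twoSidedRuin
  linarith

/-- Pathwise coupling: with the same increments, the walk from `0` lies below the walk from `u`. -/
theorem twoSidedRuin_le_ultimateRuin_zero (μ : ProbabilityMeasure ℝ) {u : ℝ} (hu : 0 ≤ u)
    (U : Set ℝ) : twoSidedRuin μ u U ≤ ultimateRuin μ 0 := by
  refine measureReal_mono fun ω hω => ?_
  obtain ⟨n, hn⟩ := (hitTime_lt_top_iff ..).1 (lt_of_lt_of_le hω le_top)
  refine (hitTime_lt_top_iff ..).2 ⟨n, ?_⟩
  have : u + ∑ i ∈ Finset.range (n + 1), ω i < 0 := hn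
  change 0 + ∑ i ∈ Finset.range (n + 1), ω i < 0
  linarith

/-! ### Persistence of symmetric walks and ruin from the origin -/

/-- The walk started at `0` is nonnegative up to step `n`. -/
def nonnegUpTo (n : ℕ) : Set (ℕ → ℝ) :=
  {ω | ∀ k ≤ n, 0 ≤ walk 0 ω k}

theorem measurableSet_nonnegUpTo (n : ℕ) : MeasurableSet (nonnegUpTo n) := by
  have heq : nonnegUpTo n = ⋂ k, ⋂ (_ : k ≤ n), {ω | 0 ≤ walk 0 ω k} := by
    ext ω; simp [nonnegUpTo]
  rw [heq]
  exact .iInter fun k => .iInter fun _ => measurableSet_le measurable_const (measurable_walk 0 k)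

theorem determinedBy_nonnegUpTo (n : ℕ) : DeterminedBy n (nonnegUpTo n) := by
  intro ω ω' h hω k hk
  rw [← walk_congr h hk]
  exact hω k hk

theorem nonnegUpTo_zero : nonnegUpTo 0 = univ := by
  ext ω; simp [nonnegUpTo, walk]

theorem real_firstEntry_Iio (q : ProbabilityMeasure ℝ) (n : ℕ) :
    (walkLaw q).real (firstEntry 0 (Iio 0) ∅ n) =
      (walkLaw q).real (nonnegUpTo n) - (walkLaw q).real (nonnegUpTo (n + 1)) := by
  have hsub : nonnegUpTo (n + 1) ⊆ nonnegUpTo n := fun ω h k hk => h k (by omega)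
  rw [← measureReal_sdiff hsub (measurableSet_nonnegUpTo _)]
  congr 1
  ext ω
  constructor
  · rintro ⟨h1, h2, -⟩
    refine ⟨fun k hk => ?_, fun h => not_lt.2 (h (n + 1) le_rfl) h1⟩
    rcases k with _ | k
    · simp [walk]
    · exact not_lt.1 (h2 k hk)
  · rintro ⟨h1, h2⟩
    refine ⟨?_, fun k hk => not_lt.2 (h1 _ hk), fun _ _ => notMem_empty _⟩
    by_contra h
    refine h2 fun k hk => ?_
    rcases hk.lt_or_eq with hk | rfl
    · exact h1 k (by omega)
    · exact not_lt.1 h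

/-- Reversal of the first `k` indices. -/
def reversePrefix (k i : ℕ) : ℕ := if i < k then k - 1 - i else i

theorem reversePrefix_injective (k : ℕ) : Function.Injective (reversePrefix k) := by
  intro i j h
  unfold reversePrefix at h
  split_ifs at h <;> omega

/-- The negated reversed walk is at `S_(k-j) - S_k` after `j` steps, so its nonnegativity up to `k`
says that `S_k` is minimal among `S_0, …, S_k`. -/
theorem walk_eq_add_reverse (ω : ℕ → ℝ) {k j : ℕ} (hj : j ≤ k) :
    walk 0 ω k = walk 0 ω (k - j) - walk 0 (fun i => -ω (reversePrefix k i)) j := by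
  induction j with
  | zero => simp [walk]
  | succ j ih =>
    have h1 : k - j = (k - (j + 1)) + 1 := by omega
    have h2 : reversePrefix k j = k - (j + 1) := by
      unfold reversePrefix; rw [if_pos (by omega)]; omega
    rw [ih (by omega), h1]
    simp only [walk, Finset.sum_range_succ, h2]
    ring

theorem walk_add (ω : ℕ → ℝ) (k j : ℕ) :
    walk 0 ω (k + j) = walk 0 ω k + walk 0 (fun i => ω (k + i)) j := by
  simp [walk, Finset.sum_range_add]

/-- Decomposition of a path at its minimum: for a symmetric walk, the persistence probabilities
have self-convolution at least one. -/
theorem one_le_sum_nonnegUpTo {q : ProbabilityMeasure ℝ}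
    (hq : (q : Measure ℝ).map (fun x => -x) = q) (n : ℕ) :
    1 ≤ ∑ k ∈ Finset.range (n + 1),
      (walkLaw q).real (nonnegUpTo k) * (walkLaw q).real (nonnegUpTo (n - k)) := by
  let R : ℕ → (ℕ → ℝ) → ℕ → ℝ := fun k ω i => -ω (reversePrefix k i)
  have hR : ∀ k, MeasurePreserving (R k) (walkLaw q) (walkLaw q) := fun k =>
    (measurePreserving_neg_walkLaw hq).comp (measurePreserving_reindex q (reversePrefix_injective k))
  have hdet : ∀ k, DeterminedBy k (R k ⁻¹' nonnegUpTo k) := fun k ω ω' h hω =>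
    determinedBy_nonnegUpTo k _ _ (fun i hi => by
      simp only [R]
      rw [h _ (by unfold reversePrefix; split_ifs; omega)]) hω
  have hcover : (univ : Set (ℕ → ℝ)) ⊆ ⋃ k ∈ Finset.range (n + 1),
      (R k ⁻¹' nonnegUpTo k) ∩ (fun ω i => ω (k + i)) ⁻¹' nonnegUpTo (n - k) := by
    intro ω _
    -- Any minimising time serves: ties make the events overlap, but the union bound needs only a
    -- cover.
    obtain ⟨k, hk, hmin⟩ := Finset.exists_min_image (Finset.range (n + 1)) (walk 0 ω)
      ⟨0, by simp⟩
    simp only [mem_iUnion]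
    have hk' := Finset.mem_range.1 hk
    refine ⟨k, hk, fun j hj => ?_, fun j hj => ?_⟩
    · have h1 := hmin (k - j) (Finset.mem_range.2 (by omega))
      have h2 := walk_eq_add_reverse ω hj
      simp only [R]
      linarith
    · have h1 := hmin (k + j) (Finset.mem_range.2 (by omega))
      have h2 := walk_add ω k j
      linarith
  calc (1 : ℝ) = (walkLaw q).real univ := by simp
    _ ≤ _ := measureReal_mono hcover (measure_ne_top _ _)
    _ ≤ _ := measureReal_biUnion_finset_le _ _
    _ = _ := Finset.sum_congr rfl fun k _ => by
      rw [walkLaw_inter_shift q (hdet k) (determinedBy_nonnegUpTo _)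
        ((hR k).measurable (measurableSet_nonnegUpTo k)) (measurableSet_nonnegUpTo _),
        (hR k).measureReal_preimage (measurableSet_nonnegUpTo k).nullMeasurableSet]

/-- If a sequence in `[0, 1]` has self-convolution at least one, then its generating function is at
least `(1 - z) ^ (-1 / 2)`. -/
theorem sqrt_one_sub_le_mul_tsum {c : ℕ → ℝ} (h0 : ∀ n, 0 ≤ c n) (h1 : ∀ n, c n ≤ 1)
    (hc : ∀ n, 1 ≤ ∑ k ∈ Finset.range (n + 1), c k * c (n - k)) {z : ℝ} (hz0 : 0 ≤ z)
    (hz1 : z < 1) : √(1 - z) ≤ (1 - z) * ∑' n, c n * z ^ n := by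
  have hgeo := summable_geometric_of_lt_one hz0 hz1
  have hsum : Summable fun n => c n * z ^ n :=
    .of_nonneg_of_le (fun n => mul_nonneg (h0 n) (pow_nonneg hz0 n))
      (fun n => mul_le_of_le_one_left (pow_nonneg hz0 n) (h1 n)) hgeo
  have hpos : 0 ≤ ∑' n, c n * z ^ n := tsum_nonneg fun n => mul_nonneg (h0 n) (pow_nonneg hz0 n)
  have hnorm : Summable fun n => ‖c n * z ^ n‖ := hsum.norm
  have hsq := tsum_mul_tsum_eq_tsum_sum_range_of_summable_norm hnorm hnorm
  have hsummable := summable_norm_sum_mul_range_of_summable_norm hnorm hnorm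
  -- The Cauchy square has coefficients at least `1`, so it dominates the geometric series.
  have hle : (1 - z)⁻¹ ≤ (∑' n, c n * z ^ n) * ∑' n, c n * z ^ n := by
    rw [hsq, ← tsum_geometric_of_lt_one hz0 hz1]
    refine hgeo.tsum_le_tsum (fun n => ?_) hsummable.of_norm
    calc z ^ n ≤ (∑ k ∈ Finset.range (n + 1), c k * c (n - k)) * z ^ n :=
          le_mul_of_one_le_left (pow_nonneg hz0 n) (hc n)
      _ = _ := by
          rw [Finset.sum_mul]
          refine Finset.sum_congr rfl fun k hk => ?_
          have : z ^ n = z ^ k * z ^ (n - k) := by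
            rw [← pow_add]; congr 1; have := Finset.mem_range.1 hk; omega
          rw [this]; ring
  have hz : 0 < 1 - z := by linarith
  refine Real.sqrt_le_iff.2 ⟨by positivity, ?_⟩
  calc 1 - z = (1 - z) ^ 2 * (1 - z)⁻¹ := by field_simp
    _ ≤ (1 - z) ^ 2 * ((∑' n, c n * z ^ n) * ∑' n, c n * z ^ n) := by gcongr
    _ = _ := by ring

/-- The ultimate ruin probability from the origin, when the half-tilted increment law is
symmetric. -/
theorem ultimateRuin_zero_le {μ q : ProbabilityMeasure ℝ} {ζ : ℝ} (hζ : 0 < ζ)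
    (hμ : (μ : Measure ℝ) =
      (q : Measure ℝ).withDensity fun x => ENNReal.ofReal (Real.exp (-ζ + 1 / 2 * x)))
    (hq : (q : Measure ℝ).map (fun x => -x) = q) :
    ultimateRuin μ 0 ≤ 1 - √(1 - Real.exp (-ζ)) := by
  set z := Real.exp (-ζ) with hz
  have hz0 : 0 ≤ z := (Real.exp_pos _).le
  have hz1 : z < 1 := Real.exp_lt_one_iff.2 (by linarith)
  set c : ℕ → ℝ := fun n => (walkLaw q).real (nonnegUpTo n) with hc
  have h0 : ∀ n, 0 ≤ c n := fun n => measureReal_nonneg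
  have h1 : ∀ n, c n ≤ 1 := fun n => measureReal_le_one
  have hsqrt := sqrt_one_sub_le_mul_tsum h0 h1 (one_le_sum_nonnegUpTo hq) hz0 hz1
  have hsum : Summable fun n => c n * z ^ n :=
    .of_nonneg_of_le (fun n => mul_nonneg (h0 n) (pow_nonneg hz0 n))
      (fun n => mul_le_of_le_one_left (pow_nonneg hz0 n) (h1 n))
      (summable_geometric_of_lt_one hz0 hz1)
  have hruin := hasSum_firstEntry μ 0 (measurableSet_Iio (a := (0 : ℝ))) MeasurableSet.empty
  simp only [hitTime_empty] at hruin
  have hshift : HasSum (fun n => c (n + 1) * z ^ (n + 1)) (∑' n, c n * z ^ n - 1) := by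
    have := (hasSum_nat_add_iff' 1).2 hsum.hasSum
    simpa [hc, nonnegUpTo_zero] using this
  -- With `C = ∑' n, c n * z ^ n`, the bounding series sums to `z * C - (C - 1) = 1 - (1 - z) * C`.
  have hbound := (hsum.hasSum.mul_left z).sub hshift
  have hle := hasSum_le (fun n => ?_) hruin hbound
  · unfold ultimateRuin
    linarith
  · have h := (determinedBy_firstEntry 0 (Iio 0) ∅ n).walkLaw_real_le
      (measurableSet_firstEntry 0 measurableSet_Iio MeasurableSet.empty n) hμ
      (c := ((n + 1 : ℕ) : ℝ) * -ζ) fun ω hω => by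
        have : 0 + ∑ i ∈ Finset.range (n + 1), ω i < 0 := hω.1
        linarith
    rw [Real.exp_nat_mul, ← hz, real_firstEntry_Iio q] at h
    refine h.trans_eq ?_
    simp only [hc]
    ring

/-! ### Convexity and uniqueness of the tilt parameter -/

/-- Strict convexity of the moment generating function. -/
theorem lintegral_exp_lt_one (μ : ProbabilityMeasure ℝ) (hne : ¬ ∀ᵐ x ∂(μ : Measure ℝ), x = 0)
    {b : ℝ} (hb : b ≠ 0) (h1 : ∫⁻ x, ENNReal.ofReal (Real.exp (-(b * x))) ∂(μ : Measure ℝ) = 1)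
    {s : ℝ} (hs0 : 0 < s) (hs1 : s < 1) :
    ∫⁻ x, ENNReal.ofReal (Real.exp (-(s * b * x))) ∂(μ : Measure ℝ) < 1 := by
  by_contra hge
  rw [not_lt] at hge
  have hs : 0 ≤ 1 - s := by linarith
  have hle : ∀ x : ℝ, Real.exp (-(s * b * x)) ≤ (1 - s) + s * Real.exp (-(b * x)) := fun x => by
    have := convexOn_exp.2 (mem_univ 0) (mem_univ (-(b * x))) hs hs0.le (by ring)
    simp only [smul_eq_mul, mul_zero, zero_add, Real.exp_zero, mul_one] at this
    rwa [show s * -(b * x) = -(s * b * x) by ring] at this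
  have hint : ∫⁻ x, ENNReal.ofReal ((1 - s) + s * Real.exp (-(b * x))) ∂(μ : Measure ℝ) = 1 := by
    have : ∀ x : ℝ, ENNReal.ofReal ((1 - s) + s * Real.exp (-(b * x))) =
        ENNReal.ofReal (1 - s) + ENNReal.ofReal s * ENNReal.ofReal (Real.exp (-(b * x))) :=
      fun x => by rw [ENNReal.ofReal_add hs (by positivity), ENNReal.ofReal_mul hs0.le]
    simp_rw [this]
    rw [lintegral_add_left measurable_const, lintegral_const_mul _ (by fun_prop), h1]
    simp only [lintegral_const, measure_univ, mul_one]
    rw [← ENNReal.ofReal_add hs hs0.le]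
    simp
  -- The chord has integral `1`; if the smaller function did too, they would agree almost
  -- everywhere, which strict convexity permits only at `x = 0`.
  have hae := ae_eq_of_ae_le_of_lintegral_le (μ := (μ : Measure ℝ))
    (f := fun x => ENNReal.ofReal (Real.exp (-(s * b * x))))
    (g := fun x => ENNReal.ofReal ((1 - s) + s * Real.exp (-(b * x))))
    (.of_forall fun x => ENNReal.ofReal_le_ofReal (hle x))
    (((lintegral_mono fun x => ENNReal.ofReal_le_ofReal (hle x)).trans_eq hint).trans_lt
      ENNReal.one_lt_top).ne (by fun_prop) (hint.trans_le hge)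
  refine hne (hae.mono fun x hx => ?_)
  by_contra hx0
  have hx' := (ENNReal.ofReal_eq_ofReal_iff (Real.exp_pos _).le (by positivity)).1 hx
  have := strictConvexOn_exp.2 (mem_univ 0) (mem_univ (-(b * x)))
    (neg_ne_zero.2 (mul_ne_zero hb hx0)).symm (by linarith : 0 < 1 - s) hs0 (by ring)
  simp only [smul_eq_mul, mul_zero, zero_add, Real.exp_zero, mul_one] at this
  rw [show s * -(b * x) = -(s * b * x) by ring] at this
  linarith

theorem IsTiltParameter.unique {μ : ProbabilityMeasure ℝ}
    (hne : ¬ ∀ᵐ x ∂(μ : Measure ℝ), x = 0) {a b : ℝ} (ha : IsTiltParameter μ a)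
    (hb : IsTiltParameter μ b) : a = b := by
  by_contra hab
  wlog h : a < b generalizing a b
  · exact this hb ha (Ne.symm hab) (lt_of_le_of_ne (not_lt.1 h) (Ne.symm hab))
  have := lintegral_exp_lt_one μ hne hb.1.ne' hb.2 (div_pos ha.1 hb.1) ((div_lt_one hb.1).2 h)
  rw [div_mul_cancel₀ _ hb.1.ne', ha.2] at this
  exact lt_irrefl _ this

/-! ### Symmetry of the log-likelihood ratio -/

namespace BMSChannel

variable {𝒴 : Type*} [MeasurableSpace 𝒴] (W : BMSChannel 𝒴)

theorem lintegral_llrLaw {f : ℝ → ENNReal} (hf : Measurable f) :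
    ∫⁻ x, f x ∂(W.llrLaw : Measure ℝ) = ∫⁻ y, ENNReal.ofReal (W.pPlus y) * f (W.llr y) ∂W.ref := by
  change ∫⁻ x, f x ∂(W.lawPlus.map W.llr) = _
  rw [lintegral_map hf W.measurable_llr, lawPlus]
  exact lintegral_withDensity_eq_lintegral_mul _ W.measurable_pPlus.ennreal_ofReal
    (hf.comp W.measurable_llr)

theorem pPlus_flip (y : 𝒴) : W.pPlus (W.flip y) = W.pMinus y := by
  rw [W.symm, W.flip_involutive y]

theorem llr_flip (y : 𝒴) : W.llr (W.flip y) = -W.llr y := by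
  unfold llr
  rw [W.pPlus_flip, ← W.symm, ← Real.log_inv, inv_div]

variable {W}

/-- Absolute continuity gives one implication; transporting it by `flip`, which swaps the densities,
gives the other. -/
theorem ae_pPlus_eq_zero_iff (hac : W.lawMinus ≪ W.lawPlus) :
    ∀ᵐ y ∂W.ref, W.pPlus y = 0 ↔ W.pMinus y = 0 := by
  have hzero : W.lawPlus {y | W.pPlus y = 0} = 0 := by
    rw [lawPlus, withDensity_apply_eq_zero W.measurable_pPlus.ennreal_ofReal]
    convert measure_empty (μ := W.ref) using 2
    ext y
    simp only [mem_inter_iff, mem_ofPred_eq, mem_empty_iff_false, iff_false, not_and]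
    intro h h0
    simp [h0] at h
  have hnull := hac hzero
  rw [lawMinus, withDensity_apply_eq_zero W.measurable_pMinus.ennreal_ofReal] at hnull
  have h1 : ∀ᵐ y ∂W.ref, W.pPlus y = 0 → W.pMinus y = 0 := by
    rw [ae_iff]
    convert hnull using 2
    ext y
    have := W.pMinus_nonneg y
    simp only [mem_ofPred_eq, mem_inter_iff, ne_eq, ENNReal.ofReal_eq_zero, not_le,
      Classical.not_imp]
    exact ⟨fun h => ⟨lt_of_le_of_ne this (Ne.symm h.2), h.1⟩, fun h => ⟨h.2, h.1.ne'⟩⟩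
  filter_upwards [h1, W.flip_preserving.quasiMeasurePreserving.ae h1] with y hy hy'
  rw [W.pPlus_flip, ← W.symm] at hy'
  exact ⟨hy, hy'⟩

/-- Almost everywhere the densities vanish together, so the default values of division and
`Real.log` at `0` are multiplied by `0`. -/
theorem ae_pPlus_mul_exp_llr (hac : W.lawMinus ≪ W.lawPlus) :
    ∀ᵐ y ∂W.ref, W.pPlus y * Real.exp (-W.llr y) = W.pMinus y ∧
      W.pPlus y * Real.exp (-(1 / 2 * W.llr y)) = √(W.pPlus y * W.pMinus y) := by
  filter_upwards [ae_pPlus_eq_zero_iff hac] with y hy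
  rcases (W.pPlus_nonneg y).eq_or_lt with h0 | hp
  · simp [← h0, hy.1 h0.symm]
  · have hm : 0 < W.pMinus y := lt_of_le_of_ne (W.pMinus_nonneg y) fun h => hp.ne' (hy.2 h.symm)
    have hexp : Real.exp (-W.llr y) = W.pMinus y / W.pPlus y := by
      rw [Real.exp_neg, llr, Real.exp_log (div_pos hp hm), inv_div]
    refine ⟨by rw [hexp]; field_simp, ?_⟩
    rw [eq_comm, Real.sqrt_eq_iff_mul_self_eq (by positivity) (by positivity)]
    have : Real.exp (-(1 / 2 * W.llr y)) * Real.exp (-(1 / 2 * W.llr y)) =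
        W.pMinus y / W.pPlus y := by
      rw [← Real.exp_add, ← hexp]; ring_nf
    symm
    calc _ = W.pPlus y ^ 2 *
          (Real.exp (-(1 / 2 * W.llr y)) * Real.exp (-(1 / 2 * W.llr y))) := by ring
      _ = _ := by rw [this]; field_simp

/-- Channel symmetry: reflecting the law of the LLR amounts to tilting it by `exp (-x)`. -/
theorem lintegral_neg_llrLaw (hac : W.lawMinus ≪ W.lawPlus) {f : ℝ → ENNReal} (hf : Measurable f) :
    ∫⁻ x, f (-x) ∂(W.llrLaw : Measure ℝ) =
      ∫⁻ x, f x * ENNReal.ofReal (Real.exp (-x)) ∂(W.llrLaw : Measure ℝ) := by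
  rw [W.lintegral_llrLaw (f := fun x => f (-x)) (hf.comp measurable_neg),
    W.lintegral_llrLaw (f := fun x => f x * ENNReal.ofReal (Real.exp (-x))) (by fun_prop),
    ← W.flip_preserving.lintegral_comp (f := fun y => ENNReal.ofReal (W.pPlus y) * f (-W.llr y))
      (W.measurable_pPlus.ennreal_ofReal.mul (hf.comp W.measurable_llr.neg))]
  refine lintegral_congr_ae ?_
  filter_upwards [ae_pPlus_mul_exp_llr hac] with y hy
  rw [W.pPlus_flip, W.llr_flip, neg_neg, ← hy.1, ENNReal.ofReal_mul (W.pPlus_nonneg y)]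
  ring

theorem isTiltParameter_one (hac : W.lawMinus ≪ W.lawPlus) : IsTiltParameter W.llrLaw 1 := by
  refine ⟨one_pos, ?_⟩
  have := lintegral_neg_llrLaw hac (f := fun _ => 1) measurable_const
  simpa using this.symm

/-- If `Λ = 0` almost surely, then `P_- = P_+ * exp (-Λ)` makes the two laws equal. -/
theorem not_ae_llrLaw_eq_zero (hac : W.lawMinus ≪ W.lawPlus) (hne : W.lawPlus ≠ W.lawMinus) :
    ¬ ∀ᵐ x ∂(W.llrLaw : Measure ℝ), x = 0 := by
  intro h
  have h' : ∀ᵐ y ∂W.lawPlus, W.llr y = 0 := ae_of_ae_map W.measurable_llr.aemeasurable h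
  rw [lawPlus, ae_withDensity_iff W.measurable_pPlus.ennreal_ofReal] at h'
  refine hne (withDensity_congr_ae ?_)
  filter_upwards [h', ae_pPlus_mul_exp_llr hac] with y hy hy'
  by_cases h0 : ENNReal.ofReal (W.pPlus y) = 0
  · have : W.pPlus y = 0 := le_antisymm (ENNReal.ofReal_eq_zero.1 h0) (W.pPlus_nonneg y)
    rw [← hy'.1, this, zero_mul]
  · rw [← hy'.1, hy h0]; simp

theorem lintegral_exp_half_llrLaw (hac : W.lawMinus ≪ W.lawPlus) :
    ∫⁻ x, ENNReal.ofReal (Real.exp (-(1 / 2 * x))) ∂(W.llrLaw : Measure ℝ) =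
      ∫⁻ y, ENNReal.ofReal (√(W.pPlus y * W.pMinus y)) ∂W.ref := by
  rw [W.lintegral_llrLaw (by fun_prop)]
  refine lintegral_congr_ae ?_
  filter_upwards [ae_pPlus_mul_exp_llr hac] with y hy
  rw [← hy.2, ENNReal.ofReal_mul (W.pPlus_nonneg y)]

/-- The Bhattacharyya parameter of a nontrivial channel lies in `(0, 1)` and is the moment
generating function of the LLR at `-1/2`. -/
theorem bhattacharyya_mem_Ioo (hac : W.lawMinus ≪ W.lawPlus) (hne : W.lawPlus ≠ W.lawMinus) :
    W.bhattacharyya ∈ Ioo 0 1 ∧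
      ∫⁻ x, ENNReal.ofReal (Real.exp (-(1 / 2 * x))) ∂(W.llrLaw : Measure ℝ) =
        ENNReal.ofReal W.bhattacharyya := by
  have hlt := lintegral_exp_lt_one W.llrLaw (not_ae_llrLaw_eq_zero hac hne) one_ne_zero
    (isTiltParameter_one hac).2 (s := 1 / 2) (by norm_num) (by norm_num)
  simp only [mul_one] at hlt
  have hB : W.bhattacharyya =
      (∫⁻ x, ENNReal.ofReal (Real.exp (-(1 / 2 * x))) ∂(W.llrLaw : Measure ℝ)).toReal := by
    rw [lintegral_exp_half_llrLaw hac, bhattacharyya]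
    refine integral_eq_lintegral_of_nonneg_ae (.of_forall fun y => Real.sqrt_nonneg _) ?_
    exact (W.measurable_pPlus.mul W.measurable_pMinus).sqrt.aestronglyMeasurable
  have hpos : 0 < ∫⁻ x, ENNReal.ofReal (Real.exp (-(1 / 2 * x))) ∂(W.llrLaw : Measure ℝ) := by
    rw [lintegral_pos_iff_support (by fun_prop)]
    have : (Function.support fun x : ℝ => ENNReal.ofReal (Real.exp (-(1 / 2 * x)))) = univ := by
      ext x; simp [Real.exp_pos]
    rw [this, measure_univ]
    exact one_pos
  refine ⟨?_, by rw [hB, ENNReal.ofReal_toReal (hlt.trans ENNReal.one_lt_top).ne]⟩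
  rw [hB]
  exact ⟨ENNReal.toReal_pos hpos.ne' (hlt.trans ENNReal.one_lt_top).ne,
    ENNReal.toReal_lt_of_lt_ofReal (by simpa using hlt)⟩

end BMSChannel

/-- Tilts compose additively, so the densities among `μ`, `ν` and `q` follow from those of `ν` and
`q` with respect to `μ`. -/
theorem withDensity_exp_withDensity_exp (μ : Measure ℝ) (a b a' b' : ℝ) :
    (μ.withDensity fun x => ENNReal.ofReal (Real.exp (a + b * x))).withDensity
        (fun x => ENNReal.ofReal (Real.exp (a' + b' * x))) =
      μ.withDensity fun x => ENNReal.ofReal (Real.exp ((a + a') + (b + b') * x)) := by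
  rw [← withDensity_mul _ (by fun_prop) (by fun_prop)]
  congr 1
  funext x
  rw [Pi.mul_apply, ← ENNReal.ofReal_mul (Real.exp_pos _).le, ← Real.exp_add]
  ring_nf

namespace BMSChannel

variable {𝒴 : Type*} [MeasurableSpace 𝒴] {W : BMSChannel 𝒴}

/-- The half-tilted law of the LLR is a symmetric probability measure. -/
theorem exists_symmetric_halfTilt (hac : W.lawMinus ≪ W.lawPlus) (hne : W.lawPlus ≠ W.lawMinus) :
    ∃ (ζ : ℝ) (q : ProbabilityMeasure ℝ), 0 < ζ ∧ Real.exp (-ζ) = W.bhattacharyya ∧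
      (q : Measure ℝ) = (W.llrLaw : Measure ℝ).withDensity
        (fun x => ENNReal.ofReal (Real.exp (ζ + -(1 / 2) * x))) ∧
      (q : Measure ℝ).map (fun x => -x) = q := by
  obtain ⟨⟨h0, h1⟩, hZ⟩ := bhattacharyya_mem_Ioo hac hne
  set ζ := -Real.log W.bhattacharyya with hζ
  have hexp : Real.exp (-ζ) = W.bhattacharyya := by rw [hζ, neg_neg, Real.exp_log h0]
  set Q := (W.llrLaw : Measure ℝ).withDensity
    (fun x => ENNReal.ofReal (Real.exp (ζ + -(1 / 2) * x))) with hQ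
  have hprob : IsProbabilityMeasure Q := ⟨by
    rw [hQ, withDensity_apply _ MeasurableSet.univ, Measure.restrict_univ]
    have : ∀ x : ℝ, ENNReal.ofReal (Real.exp (ζ + -(1 / 2) * x)) =
        ENNReal.ofReal (Real.exp ζ) * ENNReal.ofReal (Real.exp (-(1 / 2 * x))) := fun x => by
      rw [← ENNReal.ofReal_mul (Real.exp_pos _).le, ← Real.exp_add, neg_mul]
    simp_rw [this]
    rw [lintegral_const_mul _ (by fun_prop), hZ, ← ENNReal.ofReal_mul (Real.exp_pos _).le, ← hexp,
      ← Real.exp_add]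
    simp⟩
  refine ⟨ζ, ⟨Q, hprob⟩, neg_pos.2 (Real.log_neg h0 h1), hexp, rfl, ?_⟩
  change Q.map (fun x => -x) = Q
  ext s hs
  rw [Measure.map_apply measurable_neg hs, hQ, withDensity_apply _ hs,
    withDensity_apply _ (measurable_neg hs), ← lintegral_indicator hs,
    ← lintegral_indicator (measurable_neg hs)]
  -- The exponent `1 / 2` is the fixed point of the symmetry: reflection turns `x / 2` into `-x /
  -- 2`, and so does the factor `exp (-x)`.
  have h := lintegral_neg_llrLaw hac
    (f := s.indicator fun x => ENNReal.ofReal (Real.exp (ζ + 1 / 2 * x)))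
    (Measurable.indicator (by fun_prop) hs)
  convert h using 2
  · funext x
    by_cases hx : -x ∈ s
    · rw [indicator_of_mem hx, indicator_of_mem (show x ∈ (fun x => -x) ⁻¹' s from hx)]
      ring_nf
    · rw [indicator_of_notMem hx, indicator_of_notMem (show x ∉ (fun x => -x) ⁻¹' s from hx)]
  · funext x
    by_cases hx : x ∈ s
    · rw [indicator_of_mem hx, indicator_of_mem hx, ← ENNReal.ofReal_mul (Real.exp_pos _).le,
        ← Real.exp_add]
      ring_nf
    · rw [indicator_of_notMem hx, indicator_of_notMem hx, zero_mul]

end BMSChannel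

theorem mainTheorem6 {𝒴 : Type*} [MeasurableSpace 𝒴] (W : BMSChannel 𝒴)
    (hac : W.lawMinus ≪ W.lawPlus) (hne : W.lawPlus ≠ W.lawMinus) :
    (∃! lam : ℝ, IsTiltParameter W.llrLaw lam) ∧
    ∀ (lam : ℝ) (hlam : IsTiltParameter W.llrLaw lam) (A : ℝ), 0 < A →
      -- the upper barrier may be taken as `S_n ≥ A` or as `S_n > A`
      ∀ U : Set ℝ, (U = Ici A ∨ U = Ioi A) →
        (∀ u ∈ Ico 0 A, 0 < twoSidedRuin (tiltedLaw W.llrLaw lam hlam) u U) ∧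
        (∀ u ∈ Ico 0 A, exitRatio W.llrLaw lam hlam U u ≤ Real.exp (-u) ∧ Real.exp (-u) ≤ 1) ∧
        BddAbove (exitRatio W.llrLaw lam hlam U '' Ico 0 A) ∧
        sSup (exitRatio W.llrLaw lam hlam U '' Ico 0 A) ≤
          max (ultimateRuin W.llrLaw 0 / (1 - Real.exp (-(A / 2)))) (Real.exp (-(A / 2))) ∧
        max (ultimateRuin W.llrLaw 0 / (1 - Real.exp (-(A / 2)))) (Real.exp (-(A / 2))) ≤
          max (W.ruinParameter / (1 - Real.exp (-(A / 2)))) (Real.exp (-(A / 2))) := by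
  have hnz := BMSChannel.not_ae_llrLaw_eq_zero hac hne
  have hone := BMSChannel.isTiltParameter_one hac
  refine ⟨⟨1, hone, fun lam h => h.unique hnz hone⟩, ?_⟩
  intro lam hlam A hA U hU
  obtain rfl : lam = 1 := hlam.unique hnz hone
  obtain ⟨ζ, q, hζ, hZ, hq, hqs⟩ := BMSChannel.exists_symmetric_halfTilt hac hne
  have hUm : MeasurableSet U := by
    rcases hU with rfl | rfl
    exacts [measurableSet_Ici, measurableSet_Ioi]
  have hUA : U ⊆ Ici A := by
    rcases hU with rfl | rfl
    exacts [subset_rfl, Ioi_subset_Ici_self]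
  set μ := W.llrLaw
  set ν := tiltedLaw μ 1 hlam with hν_def
  have hν : (ν : Measure ℝ) =
      (μ : Measure ℝ).withDensity fun x => ENNReal.ofReal (Real.exp (0 + -1 * x)) := by
    simp [hν_def, tiltedLaw]
  have hμν : (μ : Measure ℝ) =
      (ν : Measure ℝ).withDensity fun x => ENNReal.ofReal (Real.exp (0 + 1 * x)) := by
    rw [hν, withDensity_exp_withDensity_exp]; simp
  have hμq : (μ : Measure ℝ) =
      (q : Measure ℝ).withDensity fun x => ENNReal.ofReal (Real.exp (-ζ + 1 / 2 * x)) := by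
    rw [hq, withDensity_exp_withDensity_exp]; simp
  have hνq : (ν : Measure ℝ) =
      (q : Measure ℝ).withDensity fun x => ENNReal.ofReal (Real.exp (-ζ + -(1 / 2) * x)) := by
    rw [hq, hν, withDensity_exp_withDensity_exp]; norm_num
  have hlow : ∀ u, 1 - Real.exp (-(A - u)) ≤ twoSidedRuin ν u U :=
    one_sub_exp_le_twoSidedRuin hζ hν hνq hUm hUA
  have hpos : ∀ u ∈ Ico 0 A, 0 < twoSidedRuin ν u U := fun u hu =>
    lt_of_lt_of_le (sub_pos.2 (Real.exp_lt_one_iff.2 (by linarith [hu.2]))) (hlow u)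
  have hratio : ∀ u ∈ Ico 0 A, exitRatio μ 1 hlam U u ≤ Real.exp (-u) := fun u hu =>
    (div_le_iff₀ (hpos u hu)).2 (twoSidedRuin_le_tilted hμν hUm u)
  have hexp1 : ∀ u ∈ Ico 0 A, Real.exp (-u) ≤ 1 := fun u hu =>
    Real.exp_le_one_iff.2 (by linarith [hu.1])
  have hden : 0 < 1 - Real.exp (-(A / 2)) := sub_pos.2 (Real.exp_lt_one_iff.2 (by linarith))
  refine ⟨hpos, fun u hu => ⟨hratio u hu, hexp1 u hu⟩, ⟨1, ?_⟩, ?_, ?_⟩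
  · rintro _ ⟨u, hu, rfl⟩
    exact (hratio u hu).trans (hexp1 u hu)
  · refine csSup_le ((nonempty_Ico.2 hA).image _) ?_
    rintro _ ⟨u, hu, rfl⟩
    -- For `u ≤ A / 2` the denominator is at least `1 - exp (-(A / 2))`; for `u ≥ A / 2` the bound
    -- `exp (-u)` suffices.
    rcases le_total u (A / 2) with h | h
    · refine le_max_of_le_left (div_le_div₀ measureReal_nonneg
        (twoSidedRuin_le_ultimateRuin_zero μ hu.1 U) hden (le_trans ?_ (hlow u)))
      exact sub_le_sub_left (Real.exp_le_exp.2 (by linarith)) 1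
    · exact le_max_of_le_right ((hratio u hu).trans (Real.exp_le_exp.2 (by linarith)))
  · refine max_le_max_right _ (div_le_div_of_nonneg_right ?_ hden.le)
    have := ultimateRuin_zero_le hζ hμq hqs
    rwa [hZ] at this
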